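/- Let $n\in\mathbb N$, $1<p<\infty$, $\beta<p-1$, and let $\Omega\subset\mathbb R^n$ be open, with complement $\Omega^c=\mathbb R^n\setminus\Omega$ and $d_\Omega(x)=\operatorname{dist}(x,\Omega^c)$ (with $\operatorname{dist}(x,\emptyset)=\infty$). For $E\subset\mathbb R^n$, the upper Assouad dimension $\overline{\dim}_A(E)$ is the infimum of all $s\ge 0$ for which there is $C\ge 1$ such that for all $x\in E$ and all $0<r<R<\operatorname{diam}(E)$ the set $E\cap B(x,R)$ can be covered by at most $C(r/R)^{-s}$ balls of radius $r$. The lower Assouad dimension $\underline{\dim}_A(E)$ is the supremum of all $t\ge 0$ for which there is $c>0$ such that for all $x\in E$ and all $0<r<R<\operatorname{diam}(E)$ at least $c(r/R)^{-t}$ balls of radius $r$ are needed to cover $E\cap B(x,R)$. Here balls are closed, and $\operatorname{diam}(E)=\infty$ if $E$ is unbounded. Suppose that $$\overline{\dim}_A(\Omega^c)<n-p+\beta ,$$ or that $$\underline{\dim}_A(\Omega^c)>n-p+\beta \quad\text{and, in case } \Omega \text{ is unbounded, } \Omega^c \text{ is unbounded as well.}$$ Then $\Omega$ admits a $(p,\beta)$-Hardy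 inequality: there is a constant $0<C<\infty$ such that $$\int_\Omega |u(x)|^p\, d_\Omega(x)^{\beta-p}\,dx\le C\int_\Omega |\nabla u(x)|^p\, d_\Omega(x)^{\beta}\,dx$$ for every Lipschitz function $u$ with compact support in $\Omega$. -/

import Mathlib

open scoped NNReal ENNReal
open MeasureTheory

/-- `s ≥ 0` is an admissible exponent for the upper Assouad dimension of `E`: there is `C ≥ 1`
such that for all `x ∈ E` and `0 < r < R < diam E` the set `E ∩ B(x, R)` can be covered by at most
`C (r / R) ^ (-s)` closed balls of radius `r`. (The diameter takes the value `∞` on unbounded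
sets.) -/
def IsUpperAssouadExponent {X : Type*} [PseudoMetricSpace X] (E : Set X) (s : ℝ) : Prop :=
  0 ≤ s ∧ ∃ C : ℝ, 1 ≤ C ∧ ∀ x ∈ E, ∀ r R : ℝ, 0 < r → r < R →
    ENNReal.ofReal R < Metric.ediam E →
    ∃ F : Finset X, E ∩ Metric.closedBall x R ⊆ ⋃ y ∈ F, Metric.closedBall y r ∧
      (F.card : ℝ) ≤ C * (r / R) ^ (-s)

/-- `t ≥ 0` is an admissible exponent for the lower Assouad dimension of `E`: there is `c > 0`
such that for all `x ∈ E` and `0 < r < R < diam E` at least `c (r / R) ^ (-t)` closed balls of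
radius `r` are needed to cover `E ∩ B(x, R)`. -/
def IsLowerAssouadExponent {X : Type*} [PseudoMetricSpace X] (E : Set X) (t : ℝ) : Prop :=
  0 ≤ t ∧ ∃ c : ℝ, 0 < c ∧ ∀ x ∈ E, ∀ r R : ℝ, 0 < r → r < R →
    ENNReal.ofReal R < Metric.ediam E →
    ∀ F : Finset X, E ∩ Metric.closedBall x R ⊆ ⋃ y ∈ F, Metric.closedBall y r →
      c * (r / R) ^ (-t) ≤ (F.card : ℝ)

/-- The upper Assouad dimension: the infimum of the admissible exponents, an extended real number
(`⊤` if there is no admissible exponent). -/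
noncomputable def upperAssouadDim {X : Type*} [PseudoMetricSpace X] (E : Set X) : EReal :=
  sInf ((fun s : ℝ => (s : EReal)) '' {s : ℝ | IsUpperAssouadExponent E s})

/-- The lower Assouad dimension: the supremum of the admissible exponents, an extended real
number. -/
noncomputable def lowerAssouadDim {X : Type*} [PseudoMetricSpace X] (E : Set X) : EReal :=
  sSup ((fun t : ℝ => (t : EReal)) '' {t : ℝ | IsLowerAssouadExponent E t})

/-- `u ∈ Lip₀(Ω)`: `u` is a Lipschitz function whose support is a compact subset of `Ω`. The
function is regarded as extended by zero to the whole space; for `Ω` open this is the same as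
being Lipschitz on `Ω` with compact support in `Ω`. -/
def MemLipZero {X : Type*} [PseudoMetricSpace X] (Ω : Set X) (u : X → ℝ) : Prop :=
  (∃ L : ℝ≥0, LipschitzWith L u) ∧ HasCompactSupport u ∧ tsupport u ⊆ Ω

/-- `Ω ⊆ ℝⁿ` admits a `(p, β)`-Hardy inequality: there is a finite constant `C > 0` with
`∫_Ω |u|^p d_Ω^(β - p) dx ≤ C ∫_Ω |∇u|^p d_Ω^β dx` for all `u ∈ Lip₀(Ω)`, where
`d_Ω(x) = dist(x, Ωᶜ)`. The integrals are those of `[0, ∞]`-valued functions, and the distance to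
the empty set is `∞`. -/
def AdmitsHardy {n : ℕ} (Ω : Set (EuclideanSpace ℝ (Fin n))) (p β : ℝ) : Prop :=
  ∃ C : ℝ≥0, 0 < C ∧ ∀ u : EuclideanSpace ℝ (Fin n) → ℝ, MemLipZero Ω u →
    ∫⁻ x in Ω, ‖u x‖ₑ ^ p * Metric.infEDist x Ωᶜ ^ (β - p) ≤
      (C : ℝ≥0∞) * ∫⁻ x in Ω, ‖gradient u x‖ₑ ^ p * Metric.infEDist x Ωᶜ ^ β

/-!
By Hölder's inequality, applied to the weighted `L¹` inequality for `|u| ^ p`, it suffices to prove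
`∫ |u| d ^ (-q) ≤ C ∫ |∇u| d ^ (1 - q)` with `q = p - β > 1` and `d = dist(·, Ωᶜ)`. Comparing `u`
at a point `x` with its average over the part of the `ρR`-ball around `x` that meets the
`τR`-neighbourhood of `Ωᶜ`, and integrating over `{d < R}`, gives
`m ∫_{d < R} |u| ≤ M ∫_{d < τR} |u| + B R ∫_{d < (ρ + 1)R} |∇u|`. Here, in units of the measure of
an `R`-ball, `m` bounds from below the measure of the `τR`-neighbourhood in `ρR`-balls centred in
`{d < R}`, and `M` bounds from above the measure of the `R`-neighbourhood in arbitrary `ρR`-balls.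
Integrating against `q R ^ (-q - 1) dR` turns this into the weighted inequality as soon as
`M τ ^ q ≤ m / 2`: the first term on the right is then absorbed, being finite for `u` compactly
supported in `Ω`.

If `Ωᶜ` has upper Assouad dimension below `s < n - q`, then `ρ = K` and `τ = K + 1` with `K` large
will do: `m = K ^ n`, while `M` is of order `K ^ s`. If it has lower Assouad dimension above
`t > n - q`, then `ρ = 3` and `τ = l` small will do: `M = 3 ^ n`, while `m` is of order
`l ^ (n - t)`.
-/

section Translation

open Metric Set

theorem enorm_sub_le_lintegral_enorm_deriv {g : ℝ → ℝ} {a b : ℝ}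
    (hg : AbsolutelyContinuousOnInterval g a b) (hab : a ≤ b) :
    ‖g b - g a‖ₑ ≤ ∫⁻ s in Ioc a b, ‖deriv g s‖ₑ := by
  rw [← hg.integral_deriv_eq_sub, intervalIntegral.integral_of_le hab]
  exact enorm_integral_le_lintegral_enorm _

theorem lintegral_setLIntegral_ball {X : Type*} [PseudoMetricSpace X] [SecondCountableTopology X]
    [MeasurableSpace X] [OpensMeasurableSpace X] {μ ν : Measure X} [SFinite μ] [SFinite ν]
    {g : X → ℝ≥0∞} (hg : Measurable g) (ρ : ℝ) :
    ∫⁻ x, ∫⁻ y in ball x ρ, g y ∂ν ∂μ = ∫⁻ y, μ (ball y ρ) * g y ∂ν := by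
  have hS : MeasurableSet {z : X × X | dist z.2 z.1 < ρ} :=
    (isOpen_lt (by fun_prop) continuous_const).measurableSet
  calc ∫⁻ x, ∫⁻ y in ball x ρ, g y ∂ν ∂μ
      = ∫⁻ x, ∫⁻ y, {z : X × X | dist z.2 z.1 < ρ}.indicator (fun z => g z.2) (x, y) ∂ν ∂μ :=
        lintegral_congr fun x => (lintegral_indicator measurableSet_ball _).symm
    _ = ∫⁻ y, ∫⁻ x, {z : X × X | dist z.2 z.1 < ρ}.indicator (fun z => g z.2) (x, y) ∂μ ∂ν :=
        lintegral_lintegral_swap ((hg.comp measurable_snd).indicator hS).aemeasurable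
    _ = ∫⁻ y, ∫⁻ _ in ball y ρ, g y ∂μ ∂ν := by
        refine lintegral_congr fun y => ?_
        rw [← lintegral_indicator measurableSet_ball]
        refine lintegral_congr fun x => ?_
        simp [indicator, dist_comm]
    _ = ∫⁻ y, μ (ball y ρ) * g y ∂ν := by simp only [setLIntegral_const, mul_comm]

theorem measure_ball_inter_mul_enorm_le {X : Type*} [NormedAddCommGroup X] [MeasurableSpace X]
    [BorelSpace X] {μ : Measure X} [μ.IsAddLeftInvariant] {v : X → ℝ} (hv : Measurable v)
    (B : Set X) (x : X) (ρ : ℝ) :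
    μ (ball x ρ ∩ B) * ‖v x‖ₑ ≤
      ∫⁻ y in ball x ρ, ‖v y‖ₑ ∂(μ.restrict B) + ∫⁻ h in ball 0 ρ, ‖v (x + h) - v x‖ₑ ∂μ := by
  have hmeas : Measurable fun y => ‖v y - v x‖ₑ := by fun_prop
  have htrans : ∫⁻ h in ball 0 ρ, ‖v (x + h) - v x‖ₑ ∂μ = ∫⁻ y in ball x ρ, ‖v y - v x‖ₑ ∂μ := by
    rw [← (measurePreserving_add_left μ x).setLIntegral_comp_preimage measurableSet_ball hmeas,
      preimage_add_ball, sub_self]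
  calc μ (ball x ρ ∩ B) * ‖v x‖ₑ = ∫⁻ _ in ball x ρ, ‖v x‖ₑ ∂(μ.restrict B) := by
        rw [setLIntegral_const, Measure.restrict_apply measurableSet_ball, mul_comm]
    _ ≤ ∫⁻ y in ball x ρ, (‖v y‖ₑ + ‖v y - v x‖ₑ) ∂(μ.restrict B) := by
        refine lintegral_mono fun y => ?_
        simpa using enorm_sub_le (a := v y) (b := v y - v x)
    _ = ∫⁻ y in ball x ρ, ‖v y‖ₑ ∂(μ.restrict B) +
          ∫⁻ y in ball x ρ, ‖v y - v x‖ₑ ∂(μ.restrict B) := lintegral_add_right _ hmeas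
    _ ≤ _ := by
        rw [htrans]
        gcongr
        exact Measure.restrict_le_self

variable {X : Type*} [NormedAddCommGroup X] [NormedSpace ℝ X]

theorem enorm_add_sub_le_lintegral_enorm_fderiv {v : X → ℝ} {L : ℝ≥0} (hv : LipschitzWith L v)
    {x h : X} (hd : ∀ᵐ s : ℝ, DifferentiableAt ℝ v (x + s • h)) :
    ‖v (x + h) - v x‖ₑ ≤ ‖h‖ₑ * ∫⁻ s : ℝ in Ioc 0 1, ‖fderiv ℝ v (x + s • h)‖ₑ := by
  have hline : LipschitzWith (L * ‖h‖₊) (fun s : ℝ => v (x + s • h)) := by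
    refine hv.comp (LipschitzWith.of_dist_le_mul fun a b => ?_)
    rw [dist_add_left, dist_eq_norm, ← sub_smul, norm_smul, mul_comm, coe_nnnorm, Real.dist_eq,
      Real.norm_eq_abs]
  have hderiv : ∀ᵐ s : ℝ, ‖deriv (fun s : ℝ => v (x + s • h)) s‖ₑ ≤
      ‖h‖ₑ * ‖fderiv ℝ v (x + s • h)‖ₑ := by
    filter_upwards [hd] with s hs
    have hpath : HasDerivAt (fun s : ℝ => x + s • h) h s := by
      simpa using ((hasDerivAt_id s).smul_const h).const_add x
    have hcomp : HasDerivAt (fun s : ℝ => v (x + s • h)) (fderiv ℝ v (x + s • h) h) s :=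
      hs.hasFDerivAt.comp_hasDerivAt s hpath
    rw [hcomp.deriv, mul_comm]
    exact ContinuousLinearMap.le_opENorm _ _
  calc ‖v (x + h) - v x‖ₑ ≤ ∫⁻ s in Ioc 0 1, ‖deriv (fun s : ℝ => v (x + s • h)) s‖ₑ := by
        simpa using enorm_sub_le_lintegral_enorm_deriv
          (hline.lipschitzOnWith.absolutelyContinuousOnInterval (a := 0) (b := 1)) zero_le_one
    _ ≤ ∫⁻ s in Ioc 0 1, ‖h‖ₑ * ‖fderiv ℝ v (x + s • h)‖ₑ :=
        lintegral_mono_ae (ae_restrict_of_ae hderiv)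
    _ = _ := lintegral_const_mul' _ _ enorm_ne_top

variable [FiniteDimensional ℝ X] [MeasurableSpace X] [BorelSpace X]
  {μ : Measure X} [μ.IsAddHaarMeasure] {v : X → ℝ} {L : ℝ≥0}

theorem ae_ae_differentiableAt_add_smul (hv : LipschitzWith L v) (h : X) :
    ∀ᵐ x ∂μ, ∀ᵐ s : ℝ, DifferentiableAt ℝ v (x + s • h) :=
  (ae_ae_add_linearMap_mem_iff (LinearMap.toSpanSingleton ℝ X h) (volume : Measure ℝ) μ
    (measurableSet_of_differentiableAt ℝ v)).2 hv.ae_differentiableAt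

theorem setLIntegral_enorm_add_sub_le (hv : LipschitzWith L v) {A B : Set X} {h : X}
    (hB : MeasurableSet B) (hAB : ∀ x ∈ A, ∀ s ∈ Ioc (0 : ℝ) 1, x + s • h ∈ B) :
    ∫⁻ x in A, ‖v (x + h) - v x‖ₑ ∂μ ≤ ‖h‖ₑ * ∫⁻ y in B, ‖fderiv ℝ v y‖ₑ ∂μ := by
  have hmeas : Measurable fun z : X × ℝ => ‖fderiv ℝ v (z.1 + z.2 • h)‖ₑ :=
    (measurable_fderiv ℝ v).enorm.comp (by fun_prop)
  calc ∫⁻ x in A, ‖v (x + h) - v x‖ₑ ∂μ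
      ≤ ∫⁻ x in A, ‖h‖ₑ * (∫⁻ s : ℝ in Ioc 0 1, ‖fderiv ℝ v (x + s • h)‖ₑ) ∂μ := by
        refine lintegral_mono_ae (ae_restrict_of_ae ?_)
        filter_upwards [ae_ae_differentiableAt_add_smul hv h] with x hx
        exact enorm_add_sub_le_lintegral_enorm_fderiv hv hx
    _ = ‖h‖ₑ * ∫⁻ s : ℝ in Ioc 0 1, ∫⁻ x in A, ‖fderiv ℝ v (x + s • h)‖ₑ ∂μ := by
        rw [lintegral_const_mul' _ _ enorm_ne_top, lintegral_lintegral_swap hmeas.aemeasurable]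
    _ ≤ ‖h‖ₑ * ∫⁻ _ : ℝ in Ioc 0 1, ∫⁻ y in B, ‖fderiv ℝ v y‖ₑ ∂μ := by
        gcongr ‖h‖ₑ * ?_
        refine setLIntegral_mono' measurableSet_Ioc fun s hs => ?_
        rw [← (measurePreserving_add_right μ (s • h)).setLIntegral_comp_preimage hB
          (measurable_fderiv ℝ v).enorm]
        exact lintegral_mono_set fun x hx => hAB x hx s hs
    _ = ‖h‖ₑ * ∫⁻ y in B, ‖fderiv ℝ v y‖ₑ ∂μ := by simp

theorem setLIntegral_setLIntegral_ball_enorm_add_sub_le (hv : LipschitzWith L v) (A : Set X)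
    (ρ : ℝ) :
    ∫⁻ x in A, ∫⁻ h in ball 0 ρ, ‖v (x + h) - v x‖ₑ ∂μ ∂μ ≤
      μ (ball 0 ρ) * (ENNReal.ofReal ρ * ∫⁻ x in thickening ρ A, ‖fderiv ℝ v x‖ₑ ∂μ) := by
  have hmeas : Measurable fun z : X × X => ‖v (z.1 + z.2) - v z.1‖ₑ :=
    have := hv.continuous
    (by fun_prop : Continuous fun z : X × X => v (z.1 + z.2) - v z.1).measurable.enorm
  rw [lintegral_lintegral_swap hmeas.aemeasurable, mul_comm, ← setLIntegral_const]
  refine setLIntegral_mono' measurableSet_ball fun h hh => ?_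
  rw [mem_ball_zero_iff] at hh
  refine (setLIntegral_enorm_add_sub_le hv (B := thickening ρ A)
    isOpen_thickening.measurableSet fun x hx s hs => mem_thickening_iff.2 ⟨x, hx, ?_⟩).trans ?_
  · rw [dist_self_add_left, norm_smul, Real.norm_of_nonneg hs.1.le]
    exact (mul_le_of_le_one_left (norm_nonneg h) hs.2).trans_lt hh
  · gcongr
    rw [← ofReal_norm]
    exact ENNReal.ofReal_le_ofReal hh.le

theorem mul_setLIntegral_enorm_le (hv : LipschitzWith L v) {A B : Set X} (hA : MeasurableSet A)
    {m M : ℝ≥0∞} {ρ : ℝ} (hm : ∀ x ∈ A, m ≤ μ (ball x ρ ∩ B))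
    (hM : ∀ y, μ (ball y ρ ∩ A) ≤ M) :
    m * ∫⁻ x in A, ‖v x‖ₑ ∂μ ≤ M * ∫⁻ x in B, ‖v x‖ₑ ∂μ +
      μ (ball 0 ρ) * (ENNReal.ofReal ρ * ∫⁻ x in thickening ρ A, ‖fderiv ℝ v x‖ₑ ∂μ) := by
  have hmeas : Measurable fun x => ‖v x‖ₑ := hv.continuous.measurable.enorm
  have hcont := hv.continuous
  have hmeas' : Measurable fun x => ∫⁻ h in ball 0 ρ, ‖v (x + h) - v x‖ₑ ∂μ := by
    refine Measurable.lintegral_prod_right' (f := fun z : X × X => ‖v (z.1 + z.2) - v z.1‖ₑ) ?_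
    exact (by fun_prop : Continuous fun z : X × X => v (z.1 + z.2) - v z.1).measurable.enorm
  calc m * ∫⁻ x in A, ‖v x‖ₑ ∂μ = ∫⁻ x in A, m * ‖v x‖ₑ ∂μ := (lintegral_const_mul _ hmeas).symm
    _ ≤ ∫⁻ x in A, (∫⁻ y in ball x ρ, ‖v y‖ₑ ∂(μ.restrict B) +
          ∫⁻ h in ball 0 ρ, ‖v (x + h) - v x‖ₑ ∂μ) ∂μ :=
        setLIntegral_mono' hA fun x hx => (mul_le_mul_left (hm x hx) _).trans
          (measure_ball_inter_mul_enorm_le hcont.measurable B x ρ)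
    _ = ∫⁻ x in B, μ.restrict A (ball x ρ) * ‖v x‖ₑ ∂μ +
          ∫⁻ x in A, ∫⁻ h in ball 0 ρ, ‖v (x + h) - v x‖ₑ ∂μ ∂μ := by
        rw [lintegral_add_right _ hmeas', lintegral_setLIntegral_ball hmeas]
    _ ≤ _ := by
        gcongr ?_ + ?_
        · rw [← lintegral_const_mul _ hmeas]
          gcongr with x
          rw [Measure.restrict_apply measurableSet_ball]
          exact hM x
        · exact setLIntegral_setLIntegral_ball_enorm_add_sub_le hv A ρ

end Translation

section LayerCake

open Set

theorem lintegral_Ioi_mul_rpow {q c : ℝ} (hq : 0 < q) (hc : 0 < c) :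
    ∫⁻ R in Ioi c, ENNReal.ofReal (q * R ^ (-q - 1)) = ENNReal.ofReal (c ^ (-q)) := by
  have hlt : -q - 1 < -1 := by linarith
  rw [← ofReal_integral_eq_lintegral_ofReal ((integrableOn_Ioi_rpow_of_lt hlt hc).const_mul q),
    integral_const_mul, integral_Ioi_rpow_of_lt hlt hc, sub_add_cancel, neg_div_neg_eq,
    mul_div_cancel₀ _ hq.ne']
  filter_upwards [ae_restrict_mem measurableSet_Ioi] with R hR
  exact mul_nonneg hq.le (Real.rpow_nonneg (hc.trans hR).le _)

theorem lintegral_Ioi_zero_mul_rpow {q : ℝ} (hq : 0 < q) (a : ℝ) :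
    ∫⁻ R in Ioi (0 : ℝ), ENNReal.ofReal (q * R ^ a) = ⊤ := by
  by_contra h
  refine not_integrableOn_Ioi_rpow a ((integrable_const_mul_iff (isUnit_iff_ne_zero.2 hq.ne') _).1
    ((lintegral_ofReal_ne_top_iff_integrable ?_ ?_).1 h))
  · exact (by fun_prop : Measurable fun R : ℝ => q * R ^ a).aestronglyMeasurable
  · filter_upwards [ae_restrict_mem measurableSet_Ioi] with R hR
    exact mul_nonneg hq.le (Real.rpow_nonneg (mem_Ioi.1 hR).le a)

theorem setLIntegral_lt_ofReal_mul_rpow {q τ : ℝ} (hq : 0 < q) (hτ : 0 < τ) (c : ℝ≥0∞) :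
    ∫⁻ R in {R : ℝ | c < ENNReal.ofReal (τ * R)}, ENNReal.ofReal (q * R ^ (-q - 1)) =
      ENNReal.ofReal (τ ^ q) * c ^ (-q) := by
  induction c with
  | top => simp [ENNReal.top_rpow_of_neg (neg_neg_of_pos hq)]
  | coe t =>
    have hset : {R : ℝ | (t : ℝ≥0∞) < ENNReal.ofReal (τ * R)} = Ioi (t / τ : ℝ) := by
      ext R
      rw [mem_ofPred_eq, ← ENNReal.ofReal_coe_nnreal, ENNReal.ofReal_lt_ofReal_iff', mem_Ioi,
        div_lt_iff₀ hτ, mul_comm]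
      exact and_iff_left_of_imp t.coe_nonneg.trans_lt
    rw [hset]
    rcases eq_or_ne t 0 with rfl | ht
    · simp [lintegral_Ioi_zero_mul_rpow hq, ENNReal.zero_rpow_of_neg (neg_neg_of_pos hq),
        Real.rpow_pos_of_pos hτ]
    have ht' : (0 : ℝ) < t := by positivity
    rw [lintegral_Ioi_mul_rpow hq (by positivity), ← ENNReal.ofReal_coe_nnreal,
      ENNReal.ofReal_rpow_of_pos ht', ← ENNReal.ofReal_mul (by positivity),
      Real.div_rpow ht'.le hτ.le, Real.rpow_neg hτ.le, div_inv_eq_mul, mul_comm]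

variable {X : Type*} [MeasurableSpace X] {μ : Measure X} {f g d : X → ℝ≥0∞}

theorem lintegral_mul_rpow_mul_setLIntegral_lt [SFinite μ] (hf : Measurable f) (hd : Measurable d)
    {q τ : ℝ} (hq : 0 < q) (hτ : 0 < τ) :
    ∫⁻ R, ENNReal.ofReal (q * R ^ (-q - 1)) *
      (∫⁻ x in {x | d x < ENNReal.ofReal (τ * R)}, f x ∂μ) =
      ENNReal.ofReal (τ ^ q) * ∫⁻ x, f x * d x ^ (-q) ∂μ := by
  let F : ℝ × X → ℝ≥0∞ := {z | d z.2 < ENNReal.ofReal (τ * z.1)}.indicator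
    fun z => ENNReal.ofReal (q * z.1 ^ (-q - 1)) * f z.2
  have hF : Measurable F :=
    (by fun_prop : Measurable _).indicator (measurableSet_lt (by fun_prop) (by fun_prop))
  calc ∫⁻ R, ENNReal.ofReal (q * R ^ (-q - 1)) *
        (∫⁻ x in {x | d x < ENNReal.ofReal (τ * R)}, f x ∂μ)
      = ∫⁻ R, ∫⁻ x, F (R, x) ∂μ := by
        refine lintegral_congr fun R => ?_
        rw [← lintegral_const_mul _ hf, ← lintegral_indicator (measurableSet_lt hd (by fun_prop))]
        rfl
    _ = ∫⁻ x, (∫⁻ R, F (R, x)) ∂μ := lintegral_lintegral_swap hF.aemeasurable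
    _ = ∫⁻ x, ENNReal.ofReal (τ ^ q) * (f x * d x ^ (-q)) ∂μ := by
        refine lintegral_congr fun x => ?_
        rw [mul_left_comm, ← setLIntegral_lt_ofReal_mul_rpow hq hτ, mul_comm,
          ← lintegral_mul_const _ (by fun_prop),
          ← lintegral_indicator (measurableSet_lt (by fun_prop) (by fun_prop))]
        rfl
    _ = _ := lintegral_const_mul' _ _ ENNReal.ofReal_ne_top

theorem measurable_mul_rpow_mul_setLIntegral_lt (f : X → ℝ≥0∞) (q : ℝ) {τ : ℝ} (hτ : 0 ≤ τ) :
    Measurable fun R : ℝ => ENNReal.ofReal (q * R ^ (-q - 1)) *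
      ∫⁻ x in {x | d x < ENNReal.ofReal (τ * R)}, f x ∂μ := by
  refine Measurable.mul (by fun_prop) (Monotone.measurable fun R S hRS => ?_)
  exact lintegral_mono_set fun x hx =>
    lt_of_lt_of_le hx (ENNReal.ofReal_le_ofReal (mul_le_mul_of_nonneg_left hRS hτ))

theorem ofReal_mul_rpow_mul_ofReal {q R : ℝ} (hq : 1 < q) (hR : 0 < R) :
    ENNReal.ofReal (q * R ^ (-q - 1)) * ENNReal.ofReal R =
      ENNReal.ofReal (q / (q - 1)) * ENNReal.ofReal ((q - 1) * R ^ (-(q - 1) - 1)) := by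
  have hq' : 0 < q - 1 := sub_pos.2 hq
  rw [← ENNReal.ofReal_mul (by positivity), ← ENNReal.ofReal_mul (by positivity),
    Real.rpow_sub_one hR.ne', show -(q - 1) - 1 = -q by ring]
  congr 1
  field_simp

theorem mul_lintegral_mul_rpow_le_of_setLIntegral_lt_le [SFinite μ] (hf : Measurable f)
    (hg : Measurable g) (hd : Measurable d) {q τ σ : ℝ} {m M B : ℝ≥0∞} (hq : 1 < q) (hτ : 0 < τ)
    (hσ : 0 < σ)
    (h : ∀ R : ℝ, 0 < R → m * ∫⁻ x in {x | d x < ENNReal.ofReal R}, f x ∂μ ≤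
      M * ∫⁻ x in {x | d x < ENNReal.ofReal (τ * R)}, f x ∂μ +
        B * (ENNReal.ofReal R * ∫⁻ x in {x | d x < ENNReal.ofReal (σ * R)}, g x ∂μ)) :
    m * ∫⁻ x, f x * d x ^ (-q) ∂μ ≤
      M * (ENNReal.ofReal (τ ^ q) * ∫⁻ x, f x * d x ^ (-q) ∂μ) +
        B * (ENNReal.ofReal (q / (q - 1)) *
          (ENNReal.ofReal (σ ^ (q - 1)) * ∫⁻ x, g x * d x ^ (-(q - 1)) ∂μ)) := by
  have hq0 : 0 < q := one_pos.trans hq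
  have hf1 := measurable_mul_rpow_mul_setLIntegral_lt (μ := μ) (d := d) f q zero_le_one
  have hfτ := measurable_mul_rpow_mul_setLIntegral_lt (μ := μ) (d := d) f q hτ.le
  have hgσ := measurable_mul_rpow_mul_setLIntegral_lt (μ := μ) (d := d) g (q - 1) hσ.le
  have hone := lintegral_mul_rpow_mul_setLIntegral_lt (μ := μ) hf hd hq0 one_pos
  rw [Real.one_rpow, ENNReal.ofReal_one, one_mul] at hone
  rw [← lintegral_mul_rpow_mul_setLIntegral_lt hg hd (sub_pos.2 hq) hσ,
    ← lintegral_mul_rpow_mul_setLIntegral_lt hf hd hq0 hτ, ← hone,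
    ← lintegral_const_mul _ hf1, ← lintegral_const_mul _ hfτ, ← lintegral_const_mul _ hgσ,
    ← lintegral_const_mul _ (hgσ.const_mul _), ← lintegral_add_left (hfτ.const_mul M)]
  refine lintegral_mono fun R => ?_
  rcases le_or_gt R 0 with hR | hR
  · simp [ENNReal.ofReal_of_nonpos hR]
  calc m * (ENNReal.ofReal (q * R ^ (-q - 1)) *
        ∫⁻ x in {x | d x < ENNReal.ofReal (1 * R)}, f x ∂μ)
      ≤ ENNReal.ofReal (q * R ^ (-q - 1)) *
          (M * ∫⁻ x in {x | d x < ENNReal.ofReal (τ * R)}, f x ∂μ +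
        B * (ENNReal.ofReal R * ∫⁻ x in {x | d x < ENNReal.ofReal (σ * R)}, g x ∂μ)) := by
        rw [mul_left_comm, one_mul]
        gcongr
        exact h R hR
    _ = _ := by
        rw [← mul_assoc (ENNReal.ofReal (q / (q - 1))), ← ofReal_mul_rpow_mul_ofReal hq hR]
        ring

theorem le_two_mul_of_le_half_add {a b : ℝ≥0∞} (ha : a ≠ ⊤) (h : a ≤ a / 2 + b) :
    a ≤ 2 * b := by
  have hhalf : a / 2 ≤ b := by
    refine (ENNReal.add_le_add_iff_left (ENNReal.div_ne_top ha two_ne_zero)).1 ?_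
    rwa [ENNReal.add_halves]
  calc a = 2 * (a / 2) := (ENNReal.mul_div_cancel two_ne_zero ENNReal.ofNat_ne_top).symm
    _ ≤ 2 * b := by gcongr

end LayerCake

section HardyInequality

open Metric Set Module

/-- The `(p, β)`-Hardy inequality on `Ω` for a measure `μ` on a normed space, with the operator norm
of the Fréchet derivative in the role of `|∇u|`. -/
def HardyInequality {X : Type*} [NormedAddCommGroup X] [NormedSpace ℝ X] [MeasurableSpace X]
    (μ : Measure X) (Ω : Set X) (p β : ℝ) : Prop :=
  ∃ C : ℝ≥0, 0 < C ∧ ∀ u : X → ℝ, MemLipZero Ω u →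
    ∫⁻ x in Ω, ‖u x‖ₑ ^ p * infEDist x Ωᶜ ^ (β - p) ∂μ ≤
      C * ∫⁻ x in Ω, ‖fderiv ℝ u x‖ₑ ^ p * infEDist x Ωᶜ ^ β ∂μ

theorem HardyInequality.admitsHardy {n : ℕ} {Ω : Set (EuclideanSpace ℝ (Fin n))} {p β : ℝ}
    (h : HardyInequality volume Ω p β) : AdmitsHardy Ω p β := by
  have henorm (u : EuclideanSpace ℝ (Fin n) → ℝ) (x) : ‖gradient u x‖ₑ = ‖fderiv ℝ u x‖ₑ :=
    LinearIsometryEquiv.enorm_map _ _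
  simpa only [AdmitsHardy, HardyInequality, henorm] using h

variable {X : Type*} [NormedAddCommGroup X] [NormedSpace ℝ X]

theorem enorm_fderiv_norm_rpow_le_of_differentiableAt {F : Type*} [NormedAddCommGroup F]
    [InnerProductSpace ℝ F] {u : X → F} {x : X} (hu : DifferentiableAt ℝ u x) {r : ℝ} (hr : 1 < r) :
    ‖fderiv ℝ (fun y => ‖u y‖ ^ r) x‖ₑ ≤
      ENNReal.ofReal r * ‖u x‖ₑ ^ (r - 1) * ‖fderiv ℝ u x‖ₑ := by
  have houter : DifferentiableAt ℝ (fun z : F => ‖z‖ ^ r) (u x) :=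
    (contDiff_norm_rpow hr).differentiable one_ne_zero _
  have hnorm : ‖fderiv ℝ (fun z : F => ‖z‖ ^ r) (u x)‖ₑ =
      ENNReal.ofReal r * ‖u x‖ₑ ^ (r - 1) := by
    rw [← ofReal_norm, norm_fderiv_norm_id_rpow _ hr, ENNReal.ofReal_mul (by linarith),
      ← ENNReal.ofReal_rpow_of_nonneg (norm_nonneg _) (by linarith), ofReal_norm]
  rw [← hnorm, ← Function.comp_def (fun z : F => ‖z‖ ^ r) u, fderiv_comp x houter hu]
  exact ContinuousLinearMap.opENorm_comp_le _ _

theorem MemLipZero.comp_left {Y : Type*} [PseudoMetricSpace Y] {Ω : Set Y} {u : Y → ℝ}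
    (hu : MemLipZero Ω u) {φ : ℝ → ℝ} (hφ : LocallyLipschitz φ) (hφ0 : φ 0 = 0) :
    MemLipZero Ω (φ ∘ u) := by
  obtain ⟨⟨L, hL⟩, hcompact, hsupp⟩ := hu
  obtain ⟨K, hK⟩ := hφ.locallyLipschitzOn.exists_lipschitzOnWith_of_compact
    (hcompact.isCompact_range hL.continuous)
  refine ⟨⟨K * L, ?_⟩, hcompact.comp_left hφ0,
    (closure_mono (Function.support_comp_subset hφ0 u)).trans hsupp⟩
  exact lipschitzOnWith_univ.1 (hK.comp hL.lipschitzOnWith fun x _ => mem_range_self x)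

theorem MemLipZero.norm_rpow {Y : Type*} [PseudoMetricSpace Y] {Ω : Set Y} {u : Y → ℝ}
    (hu : MemLipZero Ω u) {r : ℝ} (hr : 1 < r) : MemLipZero Ω fun x => ‖u x‖ ^ r :=
  hu.comp_left (φ := fun t => ‖t‖ ^ r) (contDiff_norm_rpow hr).locallyLipschitz
    (by simp [(one_pos.trans hr).ne'])

theorem MemLipZero.lintegral_rpow_mul_infEDist_rpow_ne_top {Y : Type*} [MetricSpace Y]
    [MeasurableSpace Y] [OpensMeasurableSpace Y] {μ : Measure Y} [IsFiniteMeasureOnCompacts μ]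
    {Ω : Set Y} {u : Y → ℝ} (hu : MemLipZero Ω u) (hΩ : IsOpen Ω) {p q : ℝ} (hp : 0 < p)
    (hq : 0 ≤ q) : ∫⁻ x, ‖u x‖ₑ ^ p * infEDist x Ωᶜ ^ (-q) ∂μ ≠ ⊤ := by
  obtain ⟨⟨L, hL⟩, hcompact, hsupp⟩ := hu
  obtain ⟨T, hT⟩ := hcompact.exists_bound_of_continuous hL.continuous
  obtain ⟨δ, hδ, hδΩ⟩ := hcompact.isCompact.exists_thickening_subset_open hΩ hsupp
  have hdist : ∀ x ∈ tsupport u, ENNReal.ofReal δ ≤ infEDist x Ωᶜ := by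
    refine fun x hx => le_infEDist.2 fun y hy => not_lt.1 fun hxy => hy (hδΩ ?_)
    exact (mem_thickening_iff_exists_edist_lt _ _).2 ⟨x, hx, edist_comm x y ▸ hxy⟩
  have hbound : ∀ x, ‖u x‖ₑ ^ p * infEDist x Ωᶜ ^ (-q) ≤
      (tsupport u).indicator (fun _ => ENNReal.ofReal T ^ p * ENNReal.ofReal δ ^ (-q)) x := by
    intro x
    by_cases hx : x ∈ tsupport u
    · rw [indicator_of_mem hx, ENNReal.rpow_neg, ENNReal.rpow_neg, ← ofReal_norm]
      gcongr
      exacts [hT x, hdist x hx]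
    · simp [image_eq_zero_of_notMem_tsupport hx, hp]
  have hconst : ENNReal.ofReal T ^ p * ENNReal.ofReal δ ^ (-q) ≠ ⊤ :=
    ENNReal.mul_ne_top (by finiteness) (ENNReal.rpow_ne_top_of_ne_zero (by simpa) (by simp))
  refine ne_top_of_le_ne_top ?_ (lintegral_mono hbound)
  rw [lintegral_indicator_const (isClosed_tsupport u).measurableSet]
  exact ENNReal.mul_ne_top hconst hcompact.isCompact.measure_ne_top

theorem le_rpow_mul_of_le_mul_rpow_mul_rpow {a b k : ℝ≥0∞} (ha : a ≠ ⊤) {θ : ℝ} (hθ : 0 < θ)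
    (h : a ≤ k * (a ^ (1 - θ) * b ^ θ)) : a ≤ k ^ (1 / θ) * b := by
  rcases eq_or_ne a 0 with rfl | ha0
  · exact zero_le
  have hne : a ^ (1 - θ) ≠ 0 := by simp [ENNReal.rpow_eq_zero_iff, ha0, ha]
  have hne' : a ^ (1 - θ) ≠ ⊤ := by simp [ENNReal.rpow_eq_top_iff, ha0, ha]
  have hpow : a ^ θ ≤ k * b ^ θ := by
    rw [← ENNReal.mul_le_mul_iff_right hne hne', ← ENNReal.rpow_add _ _ ha0 ha, sub_add_cancel,
      ENNReal.rpow_one, mul_left_comm]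
    exact h
  calc a = (a ^ θ) ^ (1 / θ) := by
        rw [← ENNReal.rpow_mul, mul_one_div_cancel hθ.ne', ENNReal.rpow_one]
    _ ≤ (k * b ^ θ) ^ (1 / θ) := by gcongr
    _ = k ^ (1 / θ) * b := by
      rw [ENNReal.mul_rpow_of_nonneg _ _ (by positivity), ← ENNReal.rpow_mul,
        mul_one_div_cancel hθ.ne', ENNReal.rpow_one]

theorem lintegral_rpow_mul_rpow_mul_rpow_le {α : Type*} [MeasurableSpace α] {ν : Measure α}
    {f g w : α → ℝ≥0∞} (hf : AEMeasurable f ν) (hg : AEMeasurable g ν) (hw : AEMeasurable w ν)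
    (hw0 : ∀ᵐ x ∂ν, w x ≠ 0) (hwtop : ∀ᵐ x ∂ν, w x ≠ ⊤) {p p' : ℝ} (a : ℝ) (hp : 0 < p)
    (hpp' : p ≤ p') :
    ∫⁻ x, f x ^ (p' - p) * g x ^ p * w x ^ (a + p) ∂ν ≤
      (∫⁻ x, f x ^ p' * w x ^ a ∂ν) ^ (1 - p / p') *
        (∫⁻ x, g x ^ p' * w x ^ (a + p') ∂ν) ^ (p / p') := by
  have hp' : 0 < p' := hp.trans_le hpp'
  have hθ : 0 ≤ 1 - p / p' := sub_nonneg.2 ((div_le_one hp').2 hpp')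
  refine le_of_eq_of_le (lintegral_congr_ae ?_)
    (ENNReal.lintegral_mul_norm_pow_le (f := fun x => f x ^ p' * w x ^ a)
      (g := fun x => g x ^ p' * w x ^ (a + p')) (by fun_prop) (by fun_prop) hθ (by positivity)
      (sub_add_cancel _ _))
  filter_upwards [hw0, hwtop] with x h0 htop
  have hexp : a * (1 - p / p') + (a + p') * (p / p') = a + p := by field_simp; ring
  have hf' : p' * (1 - p / p') = p' - p := by field_simp
  rw [ENNReal.mul_rpow_of_nonneg _ _ hθ, ENNReal.mul_rpow_of_nonneg _ _ (by positivity),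
    ← ENNReal.rpow_mul, ← ENNReal.rpow_mul, ← ENNReal.rpow_mul, ← ENNReal.rpow_mul, hf',
    mul_div_cancel₀ p hp'.ne', ← hexp, ENNReal.rpow_add _ _ h0 htop]
  ring

variable [MeasurableSpace X] {μ : Measure X} {Ω : Set X} {p β : ℝ}

theorem hardyInequality_of_ne_top {C : ℝ≥0∞} (hC : C ≠ ⊤)
    (h : ∀ u : X → ℝ, MemLipZero Ω u → ∫⁻ x in Ω, ‖u x‖ₑ ^ p * infEDist x Ωᶜ ^ (β - p) ∂μ ≤
      C * ∫⁻ x in Ω, ‖fderiv ℝ u x‖ₑ ^ p * infEDist x Ωᶜ ^ β ∂μ) :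
    HardyInequality μ Ω p β := by
  refine ⟨C.toNNReal + 1, by positivity, fun u hu => (h u hu).trans ?_⟩
  rw [ENNReal.coe_add, ENNReal.coe_toNNReal hC]
  gcongr
  exact le_self_add

theorem setLIntegral_mul_enorm_fderiv_eq [OpensMeasurableSpace X] {u : X → ℝ}
    (hu : tsupport u ⊆ Ω) (hΩ : IsOpen Ω) (w : X → ℝ≥0∞) :
    ∫⁻ x in Ω, ‖fderiv ℝ u x‖ₑ * w x ∂μ = ∫⁻ x, ‖fderiv ℝ u x‖ₑ * w x ∂μ := by
  rw [← lintegral_indicator hΩ.measurableSet, indicator_eq_self.2]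
  refine fun x hx => hu (tsupport_fderiv_subset ℝ (subset_tsupport _ fun hderiv => hx ?_))
  have henorm : ‖fderiv ℝ u x‖ₑ = 0 := by
    rw [← ofReal_norm, hderiv, norm_zero, ENNReal.ofReal_zero]
  simp only [henorm, zero_mul]

variable [BorelSpace X] [FiniteDimensional ℝ X] [μ.IsAddHaarMeasure]

theorem setLIntegral_enorm_fderiv_norm_rpow_le {u : X → ℝ} {L : ℝ≥0} (hu : LipschitzWith L u)
    {p' : ℝ} (hp : 0 < p) (hpp' : p < p') (w : X → ℝ≥0∞) :
    ∫⁻ x in Ω, ‖fderiv ℝ (fun y => ‖u y‖ ^ (p' / p)) x‖ₑ ^ p * w x ∂μ ≤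
      ENNReal.ofReal (p' / p) ^ p *
        ∫⁻ x in Ω, ‖u x‖ₑ ^ (p' - p) * ‖fderiv ℝ u x‖ₑ ^ p * w x ∂μ := by
  rw [← lintegral_const_mul' _ _ (by finiteness)]
  refine lintegral_mono_ae (ae_restrict_of_ae ?_)
  filter_upwards [hu.ae_differentiableAt (μ := μ)] with x hx
  have hexp : (p' / p - 1) * p = p' - p := by field_simp
  calc ‖fderiv ℝ (fun y => ‖u y‖ ^ (p' / p)) x‖ₑ ^ p * w x
      ≤ (ENNReal.ofReal (p' / p) * ‖u x‖ₑ ^ (p' / p - 1) * ‖fderiv ℝ u x‖ₑ) ^ p * w x := by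
        gcongr
        exact enorm_fderiv_norm_rpow_le_of_differentiableAt hx ((one_lt_div hp).2 hpp')
    _ = _ := by
        rw [ENNReal.mul_rpow_of_nonneg _ _ hp.le, ENNReal.mul_rpow_of_nonneg _ _ hp.le,
          ← ENNReal.rpow_mul, hexp]
        ring

theorem HardyInequality.of_exponent_le (h : HardyInequality μ Ω p β) (hΩ : IsOpen Ω)
    (hne : Ωᶜ.Nonempty) {p' : ℝ} (hp : 0 < p) (hβp : β ≤ p) (hpp' : p ≤ p') :
    HardyInequality μ Ω p' (β - p + p') := by
  rcases hpp'.eq_or_lt with rfl | hpp'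
  · rwa [sub_add_cancel]
  obtain ⟨C, -, hC⟩ := h
  have hp' : 0 < p' := hp.trans hpp'
  have hθ : 0 < p / p' := by positivity
  refine hardyInequality_of_ne_top (C := (C * ENNReal.ofReal (p' / p) ^ p) ^ (1 / (p / p')))
    (by finiteness) fun u hu => ?_
  obtain ⟨L, hL⟩ := hu.1
  have hpow (x : X) : ‖‖u x‖ ^ (p' / p)‖ₑ ^ p = ‖u x‖ₑ ^ p' := by
    rw [Real.enorm_rpow_of_nonneg (norm_nonneg _) (by positivity), enorm_norm, ← ENNReal.rpow_mul,
      div_mul_cancel₀ p' hp.ne']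
  have hfin : ∫⁻ x in Ω, ‖u x‖ₑ ^ p' * infEDist x Ωᶜ ^ (β - p) ∂μ ≠ ⊤ := by
    rw [← neg_sub p β]
    exact ne_top_of_le_ne_top (hu.lintegral_rpow_mul_infEDist_rpow_ne_top hΩ hp' (sub_nonneg.2 hβp))
      (setLIntegral_le_lintegral _ _)
  have hpos : ∀ᵐ x ∂μ.restrict Ω, infEDist x Ωᶜ ≠ 0 := by
    filter_upwards [ae_restrict_mem hΩ.measurableSet] with x hx h0
    exact (mem_iff_infEDist_zero_of_closed hΩ.isClosed_compl).2 h0 hx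
  rw [add_sub_cancel_right]
  refine le_rpow_mul_of_le_mul_rpow_mul_rpow hfin hθ ?_
  have hpower := hC _ (hu.norm_rpow ((one_lt_div hp).2 hpp'))
  simp only [hpow] at hpower
  refine hpower.trans ?_
  rw [mul_assoc]
  gcongr
  refine (setLIntegral_enorm_fderiv_norm_rpow_le hL hp hpp' _).trans ?_
  gcongr
  simpa only [sub_add_cancel] using lintegral_rpow_mul_rpow_mul_rpow_le (f := fun x => ‖u x‖ₑ)
    hL.continuous.measurable.enorm.aemeasurable (measurable_fderiv ℝ u).enorm.aemeasurable
    measurable_infEDist.aemeasurable hpos (.of_forall fun x => infEDist_ne_top hne) (β - p) hp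
    hpp'.le

theorem mul_setLIntegral_thickening_enorm_le {u : X → ℝ} {L : ℝ≥0} (hu : LipschitzWith L u)
    {E : Set X} {ρ τ R : ℝ} {m M : ℝ≥0∞} (hρ : 0 < ρ) (hR : 0 < R)
    (hm : ∀ x ∈ thickening R E, m * μ (ball 0 R) ≤ μ (ball x (ρ * R) ∩ thickening (τ * R) E))
    (hM : ∀ y, μ (ball y (ρ * R) ∩ thickening R E) ≤ M * μ (ball 0 R)) :
    m * ∫⁻ x in thickening R E, ‖u x‖ₑ ∂μ ≤ M * ∫⁻ x in thickening (τ * R) E, ‖u x‖ₑ ∂μ +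
      ENNReal.ofReal (ρ ^ finrank ℝ X) * ENNReal.ofReal ρ *
        (ENNReal.ofReal R * ∫⁻ x in thickening ((ρ + 1) * R) E, ‖fderiv ℝ u x‖ₑ ∂μ) := by
  have hthick : thickening (ρ * R) (thickening R E) ⊆ thickening ((ρ + 1) * R) E := by
    rw [add_one_mul]
    exact thickening_thickening_subset _ _ _
  rw [← ENNReal.mul_le_mul_iff_right (measure_ball_pos μ 0 hR).ne' measure_ball_lt_top.ne]
  calc μ (ball 0 R) * (m * ∫⁻ x in thickening R E, ‖u x‖ₑ ∂μ)
      = m * μ (ball 0 R) * ∫⁻ x in thickening R E, ‖u x‖ₑ ∂μ := by ring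
    _ ≤ M * μ (ball 0 R) * ∫⁻ x in thickening (τ * R) E, ‖u x‖ₑ ∂μ +
          μ (ball 0 (ρ * R)) * (ENNReal.ofReal (ρ * R) *
            ∫⁻ x in thickening (ρ * R) (thickening R E), ‖fderiv ℝ u x‖ₑ ∂μ) :=
        mul_setLIntegral_enorm_le hu isOpen_thickening.measurableSet hm hM
    _ ≤ M * μ (ball 0 R) * ∫⁻ x in thickening (τ * R) E, ‖u x‖ₑ ∂μ +
          μ (ball 0 (ρ * R)) * (ENNReal.ofReal (ρ * R) *
            ∫⁻ x in thickening ((ρ + 1) * R) E, ‖fderiv ℝ u x‖ₑ ∂μ) := by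
        gcongr
    _ = _ := by
        rw [Measure.addHaar_ball_mul_of_pos μ 0 hρ R, ENNReal.ofReal_mul hρ.le]
        ring

theorem hardyInequality_one_of_measure_ball_inter_thickening (hΩ : IsOpen Ω) {q ρ τ : ℝ}
    {m M : ℝ≥0∞} (hq : 1 < q) (hρ : 0 < ρ) (hτ : 0 < τ) (hm0 : m ≠ 0) (hmtop : m ≠ ⊤)
    (hm : ∀ R : ℝ, 0 < R → ∀ x ∈ thickening R Ωᶜ,
      m * μ (ball 0 R) ≤ μ (ball x (ρ * R) ∩ thickening (τ * R) Ωᶜ))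
    (hM : ∀ R : ℝ, 0 < R → ∀ y, μ (ball y (ρ * R) ∩ thickening R Ωᶜ) ≤ M * μ (ball 0 R))
    (hmM : M * ENNReal.ofReal (τ ^ q) ≤ m / 2) :
    HardyInequality μ Ω 1 (1 - q) := by
  set K := ENNReal.ofReal (ρ ^ finrank ℝ X) * ENNReal.ofReal ρ *
    (ENNReal.ofReal (q / (q - 1)) * ENNReal.ofReal ((ρ + 1) ^ (q - 1))) with hK
  refine hardyInequality_of_ne_top (C := m⁻¹ * (2 * K))
    (ENNReal.mul_ne_top (by simpa) (by finiteness)) fun u hu => ?_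
  obtain ⟨L, hL⟩ := hu.1
  set H := ∫⁻ x, ‖u x‖ₑ * infEDist x Ωᶜ ^ (-q) ∂μ
  set G := ∫⁻ x, ‖fderiv ℝ u x‖ₑ * infEDist x Ωᶜ ^ (-(q - 1)) ∂μ
  have hfin : H ≠ ⊤ := by
    simpa only [ENNReal.rpow_one] using hu.lintegral_rpow_mul_infEDist_rpow_ne_top (μ := μ) hΩ
      one_pos (one_pos.trans hq).le
  have hweighted : m * H ≤ m * H / 2 + K * G := by
    refine (mul_lintegral_mul_rpow_le_of_setLIntegral_lt_le hL.continuous.measurable.enorm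
      (measurable_fderiv ℝ u).enorm measurable_infEDist hq hτ (by positivity) fun R hR =>
        mul_setLIntegral_thickening_enorm_le hL hρ hR (hm R hR) (hM R hR)).trans ?_
    rw [← mul_assoc M, ← mul_assoc _ _ (lintegral _ _), ← mul_assoc _ (_ * _), ← hK,
      ENNReal.mul_div_right_comm]
    gcongr
  have hmH := le_two_mul_of_le_half_add (ENNReal.mul_ne_top hmtop hfin) hweighted
  simp only [ENNReal.rpow_one, ← neg_sub q 1, setLIntegral_mul_enorm_fderiv_eq hu.2.2 hΩ]
  calc ∫⁻ x in Ω, ‖u x‖ₑ * infEDist x Ωᶜ ^ (-(q - 1) - 1) ∂μ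
      ≤ H := by
        rw [show -(q - 1) - 1 = -q by ring]
        exact setLIntegral_le_lintegral _ _
    _ = m⁻¹ * (m * H) := by rw [← mul_assoc, ENNReal.inv_mul_cancel hm0 hmtop, one_mul]
    _ ≤ m⁻¹ * (2 * K) * G := by
        rw [mul_assoc, mul_assoc]
        gcongr

end HardyInequality

section AssouadExponents

open Metric Set Module Filter

section PseudoMetricSpace

variable {Y : Type*} [PseudoMetricSpace Y] {E : Set Y} {s : ℝ}

theorem exists_finset_cover_of_forall_mem {T : Finset Y} {δ r N : ℝ}
    (hT : E ⊆ ⋃ z ∈ T, closedBall z δ)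
    (h : ∀ z ∈ T, ∃ F : Finset Y, E ∩ closedBall z δ ⊆ ⋃ y ∈ F, closedBall y r ∧ (F.card : ℝ) ≤ N) :
    ∃ F : Finset Y, E ⊆ ⋃ y ∈ F, closedBall y r ∧ (F.card : ℝ) ≤ T.card * N := by
  classical
  choose! F hF hcard using h
  refine ⟨T.biUnion F, fun y hy => ?_, ?_⟩
  · obtain ⟨z, hz, hyz⟩ := mem_iUnion₂.1 (hT hy)
    obtain ⟨w, hw, hyw⟩ := mem_iUnion₂.1 (hF z hz ⟨hy, hyz⟩)
    exact mem_iUnion₂.2 ⟨w, Finset.mem_biUnion.2 ⟨z, hz, hw⟩, hyw⟩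
  · calc ((T.biUnion F).card : ℝ) ≤ ∑ z ∈ T, ((F z).card : ℝ) :=
          mod_cast Finset.card_biUnion_le
      _ ≤ T.card * N := by
          rw [← nsmul_eq_mul]
          exact Finset.sum_le_card_nsmul _ _ _ hcard

theorem exists_finset_pairwiseDisjoint_ball_cover {A : Set Y} (hA : TotallyBounded A) {r : ℝ}
    (hr : 0 < r) : ∃ F : Finset Y, ↑F ⊆ A ∧ (F : Set Y).PairwiseDisjoint (ball · (r / 2)) ∧
      A ⊆ ⋃ y ∈ F, closedBall y r := by
  lift r to ℝ≥0 using hr.le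
  have hr' : r / 2 ≠ 0 := (half_pos (NNReal.coe_pos.1 hr)).ne'
  have hpacking : packingNumber r A ≠ ⊤ := by
    obtain ⟨N, -, hfin, hcover⟩ := exists_finite_isCover_of_totallyBounded hr' hA
    have hle := packingNumber_two_mul_le_externalCoveringNumber (r / 2) A
    rw [mul_div_cancel₀ r two_ne_zero] at hle
    exact ne_top_of_le_ne_top hfin.encard_lt_top.ne
      (hle.trans hcover.externalCoveringNumber_le_encard)
  have hfin : (maximalSeparatedSet r A).Finite := by
    rwa [← encard_ne_top_iff, encard_maximalSeparatedSet hpacking]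
  refine ⟨hfin.toFinset, by simpa using maximalSeparatedSet_subset, ?_,
    by simpa using (isCover_maximalSeparatedSet hpacking).subset_iUnion_closedBall⟩
  rw [hfin.coe_toFinset]
  refine fun y hy z hz hyz => ball_disjoint_ball ?_
  have hsep : (r : ℝ≥0∞) < edist y z := isSeparated_maximalSeparatedSet hy hz hyz
  rw [edist_nndist, ENNReal.coe_lt_coe] at hsep
  rw [add_halves]
  exact_mod_cast hsep.le

theorem IsUpperAssouadExponent.exists_cover_of_le (h : IsUpperAssouadExponent E s) :
    ∃ C : ℝ, 1 ≤ C ∧ ∀ x ∈ E, ∀ r δ R : ℝ, 0 < r → r < R → 0 < δ → δ ≤ R →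
      ENNReal.ofReal δ < ediam E → ∃ F : Finset Y,
        E ∩ closedBall x δ ⊆ ⋃ y ∈ F, closedBall y r ∧ (F.card : ℝ) ≤ C * (r / R) ^ (-s) := by
  obtain ⟨hs, C, hC, hcover⟩ := h
  refine ⟨C, hC, fun x hx r δ R hr hrR hδ hδR hδE => ?_⟩
  have hR : 0 < R := hr.trans hrR
  rcases lt_or_ge r δ with hrδ | hrδ
  · obtain ⟨F, hF, hcard⟩ := hcover x hx r δ hr hrδ hδE
    refine ⟨F, hF, hcard.trans (mul_le_mul_of_nonneg_left ?_ (by positivity))⟩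
    refine Real.rpow_le_rpow_of_nonpos (by positivity) ?_ (neg_nonpos.2 hs)
    gcongr
  · refine ⟨{x}, by simpa using inter_subset_right.trans (closedBall_subset_closedBall hrδ), ?_⟩
    simpa using one_le_mul_of_one_le_of_one_le hC (Real.one_le_rpow_of_pos_of_le_one_of_nonpos
      (by positivity) ((div_le_one hR).2 hrR.le) (neg_nonpos.2 hs))

theorem IsUpperAssouadExponent.exists_cover [ProperSpace Y] (h : IsUpperAssouadExponent E s) :
    ∃ C : ℝ, 0 < C ∧ ∀ x ∈ E, ∀ r R : ℝ, 0 < r → r < R →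
      ∃ F : Finset Y, E ∩ closedBall x R ⊆ ⋃ y ∈ F, closedBall y r ∧
        (F.card : ℝ) ≤ C * (r / R) ^ (-s) := by
  obtain ⟨C, hC, hcover⟩ := h.exists_cover_of_le
  by_cases hbdd : Bornology.IsBounded E
  swap
  · refine ⟨C, by positivity, fun x hx r R hr hrR => ?_⟩
    exact hcover x hx r R R hr hrR (hr.trans hrR) le_rfl (by simp [ediam_of_unbounded hbdd])
  have hediam : ediam E = ENNReal.ofReal (diam E) :=
    (ENNReal.ofReal_toReal hbdd.ediam_ne_top).symm
  rcases (diam_nonneg (s := E)).eq_or_lt' with hdiam | hdiam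
  · refine ⟨1, one_pos, fun x hx r R hr hrR => ⟨{x}, fun y hy => ?_, ?_⟩⟩
    · simpa using ((dist_le_diam_of_mem hbdd hy.1 hx).trans_eq hdiam).trans hr.le
    · simpa using Real.one_le_rpow_of_pos_of_le_one_of_nonpos (div_pos hr (hr.trans hrR))
        ((div_le_one (hr.trans hrR)).2 hrR.le) (neg_nonpos.2 h.1)
  obtain ⟨T, hTE, hTfin, hT⟩ :=
    exists_finite_cover_balls_of_isCompact_closure hbdd.isCompact_closure (half_pos hdiam)
  lift T to Finset Y using hTfin
  refine ⟨(T.card + 1) * C, by positivity, fun x hx r R hr hrR => ?_⟩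
  have hR : 0 < R := hr.trans hrR
  rcases lt_or_ge R (diam E) with hRE | hRE
  · obtain ⟨F, hF, hcard⟩ := hcover x hx r R R hr hrR hR le_rfl
      (by rwa [hediam, ENNReal.ofReal_lt_ofReal_iff hdiam])
    refine ⟨F, hF, hcard.trans ?_⟩
    gcongr
    exact le_mul_of_one_le_left (by positivity) (by simp)
  obtain ⟨F, hF, hcard⟩ := exists_finset_cover_of_forall_mem
    (hT.trans (iUnion₂_mono fun z _ => ball_subset_closedBall)) fun z hz =>
      hcover z (hTE hz) r (diam E / 2) R hr hrR (half_pos hdiam) ((half_le_self hdiam.le).trans hRE)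
        (by rw [hediam, ENNReal.ofReal_lt_ofReal_iff hdiam]; exact half_lt_self hdiam)
  refine ⟨F, inter_subset_left.trans hF, hcard.trans ?_⟩
  rw [← mul_assoc]
  gcongr
  simp

end PseudoMetricSpace

theorem eventually_mul_rpow_le_rpow {a b : ℝ} (hab : a < b) (C : ℝ) :
    ∀ᶠ K : ℝ in atTop, C * K ^ a ≤ K ^ b := by
  have hlim : Tendsto (fun K : ℝ => C * K ^ (-(b - a))) atTop (nhds (C * 0)) :=
    (tendsto_rpow_neg_atTop (sub_pos.2 hab)).const_mul C
  filter_upwards [hlim.eventually_le_const (by simp : C * 0 < 1), eventually_gt_atTop 0]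
    with K hK hK0
  calc C * K ^ a = C * K ^ (-(b - a)) * K ^ b := by
        rw [mul_assoc, ← Real.rpow_add hK0]
        ring_nf
    _ ≤ K ^ b := mul_le_of_le_one_left (by positivity) hK

variable {X : Type*} [NormedAddCommGroup X] [NormedSpace ℝ X] [FiniteDimensional ℝ X]
  [MeasurableSpace X] [BorelSpace X] {μ : Measure X} [μ.IsAddHaarMeasure] {E Ω : Set X}

theorem IsUpperAssouadExponent.exists_measure_ball_inter_thickening_le {s : ℝ}
    (h : IsUpperAssouadExponent E s) :
    ∃ C : ℝ, 0 < C ∧ ∀ K R : ℝ, 1 ≤ K → 0 < R → ∀ y,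
      μ (ball y (K * R) ∩ thickening R E) ≤ ENNReal.ofReal (C * K ^ s) * μ (ball 0 R) := by
  obtain ⟨C, hC, hcover⟩ := h.exists_cover
  refine ⟨C * 4 ^ s * 2 ^ finrank ℝ X, by positivity, fun K R hK hR y => ?_⟩
  rcases (ball y (K * R) ∩ thickening R E).eq_empty_or_nonempty with hempty | ⟨x₀, hx₀, hx₀E⟩
  · simp [hempty]
  obtain ⟨w, hw, hx₀w⟩ := mem_thickening_iff.1 hx₀E
  have hKR : R ≤ K * R := le_mul_of_one_le_left hR.le hK
  obtain ⟨F, hF, hcard⟩ := hcover w hw R (4 * K * R) hR (by linarith)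
  have hsub : ball y (K * R) ∩ thickening R E ⊆ ⋃ z ∈ F, ball z (2 * R) := by
    rintro x ⟨hx, hxE⟩
    obtain ⟨e, he, hxe⟩ := mem_thickening_iff.1 hxE
    rw [mem_ball] at hx hx₀
    have hew : dist e w ≤ 4 * K * R := by
      linarith [dist_triangle4_right e x y x₀, dist_triangle e x₀ w, dist_triangle_left e x₀ x,
        dist_triangle_right x x₀ y]
    obtain ⟨z, hz, hez⟩ := mem_iUnion₂.1 (hF ⟨he, hew⟩)
    rw [mem_closedBall] at hez
    refine mem_iUnion₂.2 ⟨z, hz, mem_ball.2 ?_⟩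
    linarith [dist_triangle x e z]
  have hpow : (R / (4 * K * R)) ^ (-s) = 4 ^ s * K ^ s := by
    rw [← Real.mul_rpow (by positivity) (by positivity), Real.rpow_neg (by positivity),
      ← Real.inv_rpow (by positivity), inv_div, mul_div_cancel_right₀ _ hR.ne']
  rw [hpow] at hcard
  calc μ (ball y (K * R) ∩ thickening R E)
      ≤ ∑ z ∈ F, μ (ball z (2 * R)) := (measure_mono hsub).trans (measure_biUnion_finset_le _ _)
    _ = ENNReal.ofReal (F.card * 2 ^ finrank ℝ X) * μ (ball 0 R) := by
        simp only [Measure.addHaar_ball_mul_of_pos μ _ two_pos, Finset.sum_const, nsmul_eq_mul]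
        rw [ENNReal.ofReal_mul (by positivity), ENNReal.ofReal_natCast, mul_assoc]
    _ ≤ ENNReal.ofReal (C * (4 ^ s * K ^ s) * 2 ^ finrank ℝ X) * μ (ball 0 R) := by
        gcongr
    _ = _ := by ring_nf

theorem IsLowerAssouadExponent.exists_le_measure_ball_inter_thickening {t : ℝ}
    (h : IsLowerAssouadExponent E t) (hE : ¬ Bornology.IsBounded E) :
    ∃ c : ℝ, 0 < c ∧ ∀ l R : ℝ, 0 < l → l < 1 → 0 < R → ∀ x ∈ thickening R E,
      ENNReal.ofReal (c * l ^ (finrank ℝ X - t)) * μ (ball 0 R) ≤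
        μ (ball x (3 * R) ∩ thickening (l * R) E) := by
  obtain ⟨-, c, hc, hcover⟩ := h
  refine ⟨c / 2 ^ finrank ℝ X, by positivity, fun l R hl hl1 hR x hx => ?_⟩
  obtain ⟨w, hw, hxw⟩ := mem_thickening_iff.1 hx
  have hlR : l * R < R := mul_lt_of_lt_one_left hR hl1
  have hlR0 : 0 < l * R := by positivity
  have htb : TotallyBounded (E ∩ closedBall w R) :=
    (isCompact_closedBall w R).totallyBounded.subset inter_subset_right
  obtain ⟨F, hFE, hdisj, hF⟩ := exists_finset_pairwiseDisjoint_ball_cover htb hlR0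
  have hcard : c * l ^ (-t) ≤ F.card := by
    simpa only [mul_div_cancel_right₀ l hR.ne'] using
      hcover w hw (l * R) R hlR0 hlR (by simp [ediam_of_unbounded hE]) F hF
  have hsub : ⋃ z ∈ F, ball z (l * R / 2) ⊆ ball x (3 * R) ∩ thickening (l * R) E := by
    refine iUnion₂_subset fun z hz y hyz => ?_
    obtain ⟨hzE, hzw⟩ := hFE hz
    rw [mem_ball] at hyz
    rw [mem_closedBall] at hzw
    refine ⟨mem_ball.2 ?_, mem_thickening_iff.2 ⟨z, hzE, by linarith⟩⟩
    linarith [dist_triangle4_right y z x w, dist_triangle y z x, dist_triangle_right z x w]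
  have hpow : l ^ (finrank ℝ X - t) = l ^ (-t) * l ^ finrank ℝ X := by
    rw [← Real.rpow_natCast, ← Real.rpow_add hl, neg_add_eq_sub]
  calc ENNReal.ofReal (c / 2 ^ finrank ℝ X * l ^ (finrank ℝ X - t)) * μ (ball 0 R)
      = ENNReal.ofReal (c * l ^ (-t) * (l / 2) ^ finrank ℝ X) * μ (ball 0 R) := by
        rw [hpow, div_pow]
        ring_nf
    _ ≤ ENNReal.ofReal (F.card * (l / 2) ^ finrank ℝ X) * μ (ball 0 R) := by
        gcongr
    _ = ∑ z ∈ F, μ (ball z (l * R / 2)) := by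
        simp only [mul_div_right_comm l R 2, Measure.addHaar_ball_mul_of_pos μ _ (half_pos hl),
          Finset.sum_const, nsmul_eq_mul]
        rw [ENNReal.ofReal_mul (by positivity), ENNReal.ofReal_natCast, mul_assoc]
    _ = μ (⋃ z ∈ F, ball z (l * R / 2)) :=
        (measure_biUnion_finset hdisj fun z _ => measurableSet_ball).symm
    _ ≤ _ := measure_mono hsub

theorem IsUpperAssouadExponent.hardyInequality_one {q s : ℝ} (h : IsUpperAssouadExponent Ωᶜ s)
    (hΩ : IsOpen Ω) (hq : 1 < q) (hsq : s + q < finrank ℝ X) : HardyInequality μ Ω 1 (1 - q) := by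
  obtain ⟨C, hC, hmeasure⟩ := h.exists_measure_ball_inter_thickening_le (μ := μ)
  obtain ⟨K, hK, hK1⟩ := ((eventually_mul_rpow_le_rpow hsq (2 * C * 2 ^ q)).and
    (eventually_ge_atTop 1)).exists
  have hK0 : 0 < K := by positivity
  refine hardyInequality_one_of_measure_ball_inter_thickening hΩ (ρ := K) (τ := K + 1)
    (m := ENNReal.ofReal (K ^ finrank ℝ X)) (M := ENNReal.ofReal (C * K ^ s)) hq hK0
    (by positivity) (by simpa using by positivity) ENNReal.ofReal_ne_top (fun R _ x hx => ?_)
    (fun R hR y => hmeasure K R hK1 hR y) ?_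
  · have hsub : ball x (K * R) ⊆ thickening ((K + 1) * R) Ωᶜ := by
      rw [add_one_mul]
      exact (ball_subset_thickening hx _).trans (thickening_thickening_subset _ _ _)
    rw [inter_eq_left.2 hsub, Measure.addHaar_ball_mul_of_pos μ x hK0]
  · have hpow : (K + 1) ^ q ≤ 2 ^ q * K ^ q := by
      rw [← Real.mul_rpow two_pos.le hK0.le]
      exact Real.rpow_le_rpow (by positivity) (by linarith) (by positivity)
    rw [← ENNReal.ofReal_mul (by positivity), ENNReal.le_div_iff_mul_le (by simp) (by simp),
      ← ENNReal.ofReal_ofNat 2, ← ENNReal.ofReal_mul (by positivity)]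
    refine ENNReal.ofReal_le_ofReal ?_
    calc C * K ^ s * (K + 1) ^ q * 2 ≤ C * K ^ s * (2 ^ q * K ^ q) * 2 := by gcongr
      _ = 2 * C * 2 ^ q * K ^ (s + q) := by rw [Real.rpow_add hK0]; ring
      _ ≤ K ^ finrank ℝ X := by simpa using hK

theorem IsLowerAssouadExponent.hardyInequality_one {q t : ℝ} (h : IsLowerAssouadExponent Ωᶜ t)
    (hΩ : IsOpen Ω) (hunb : ¬ Bornology.IsBounded Ωᶜ) (hq : 1 < q) (htq : finrank ℝ X < t + q) :
    HardyInequality μ Ω 1 (1 - q) := by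
  obtain ⟨c, hc, hmeasure⟩ := h.exists_le_measure_ball_inter_thickening (μ := μ) hunb
  obtain ⟨K, hK, hK1⟩ := ((eventually_mul_rpow_le_rpow (show -q < t - finrank ℝ X by linarith)
    (2 * 3 ^ finrank ℝ X / c)).and (eventually_gt_atTop 1)).exists
  have hK0 : 0 < K := by positivity
  refine hardyInequality_one_of_measure_ball_inter_thickening hΩ (ρ := 3) (τ := K⁻¹)
    (m := ENNReal.ofReal (c * K⁻¹ ^ (finrank ℝ X - t))) (M := ENNReal.ofReal (3 ^ finrank ℝ X)) hq
    three_pos (by positivity) (by simpa using by positivity) ENNReal.ofReal_ne_top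
    (fun R hR x hx => hmeasure K⁻¹ R (by positivity) (inv_lt_one_of_one_lt₀ hK1) hR x hx)
    (fun R _ y => ?_) ?_
  · rw [← Measure.addHaar_ball_mul_of_pos μ y three_pos]
    exact measure_mono inter_subset_left
  · rw [← ENNReal.ofReal_mul (by positivity), ENNReal.le_div_iff_mul_le (by simp) (by simp),
      ← ENNReal.ofReal_ofNat 2, ← ENNReal.ofReal_mul (by positivity)]
    refine ENNReal.ofReal_le_ofReal ?_
    rw [Real.inv_rpow hK0.le, Real.inv_rpow hK0.le, ← Real.rpow_neg hK0.le, ← Real.rpow_neg hK0.le,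
      neg_sub]
    calc 3 ^ finrank ℝ X * K ^ (-q) * 2 = c * (2 * 3 ^ finrank ℝ X / c * K ^ (-q)) := by
          field_simp
      _ ≤ c * K ^ (t - finrank ℝ X) := by gcongr

end AssouadExponents

theorem corollary1p3_general {X : Type*} [NormedAddCommGroup X] [NormedSpace ℝ X]
    [FiniteDimensional ℝ X] [MeasurableSpace X] [BorelSpace X] (μ : Measure X)
    [μ.IsAddHaarMeasure] {p β : ℝ} (hp : 1 ≤ p) (hβ : β < p - 1) {Ω : Set X} (hΩ : IsOpen Ω)
    (hdim : upperAssouadDim Ωᶜ < ((Module.finrank ℝ X - p + β : ℝ) : EReal) ∨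
      (((Module.finrank ℝ X - p + β : ℝ) : EReal) < lowerAssouadDim Ωᶜ ∧
        (¬ Bornology.IsBounded Ω → ¬ Bornology.IsBounded Ωᶜ))) :
    HardyInequality μ Ω p β := by
  rcases Ω.eq_empty_or_nonempty with rfl | ⟨x, hx⟩
  · exact ⟨1, one_pos, by simp⟩
  rcases Ωᶜ.eq_empty_or_nonempty with hempty | ⟨y, hy⟩
  · refine ⟨1, one_pos, fun u _ => ?_⟩
    simp [hempty, ENNReal.top_rpow_of_neg (by linarith : β - p < 0)]
  suffices h : HardyInequality μ Ω 1 (1 - (p - β)) by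
    convert h.of_exponent_le hΩ ⟨y, hy⟩ one_pos (by linarith) hp using 1
    ring
  have hq : 1 < p - β := by linarith
  rcases hdim with hdim | ⟨hdim, hunb⟩
  · obtain ⟨_, ⟨s, hs, rfl⟩, hlt⟩ := sInf_lt_iff.1 hdim
    exact hs.hardyInequality_one hΩ hq (by linarith [EReal.coe_lt_coe_iff.1 hlt])
  · obtain ⟨_, ⟨t, ht, rfl⟩, hlt⟩ := lt_sSup_iff.1 hdim
    have : Nontrivial X := ⟨x, y, fun hxy => hy (hxy ▸ hx)⟩
    have hunb' : ¬ Bornology.IsBounded Ωᶜ := fun hbdd => hunb (fun hbdd' =>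
      NormedSpace.unbounded_univ ℝ X (Ω.union_compl_self ▸ hbdd'.union hbdd)) hbdd
    exact ht.hardyInequality_one hΩ hunb' hq (by linarith [EReal.coe_lt_coe_iff.1 hlt])

theorem corollary1p3 (n : ℕ) (p β : ℝ) (hp : 1 < p) (hβ : β < p - 1)
    (Ω : Set (EuclideanSpace ℝ (Fin n))) (hΩ : IsOpen Ω)
    (hdim : upperAssouadDim Ωᶜ < (((n : ℝ) - p + β : ℝ) : EReal) ∨
      ((((n : ℝ) - p + β : ℝ) : EReal) < lowerAssouadDim Ωᶜ ∧
        (¬ Bornology.IsBounded Ω → ¬ Bornology.IsBounded Ωᶜ))) :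
    AdmitsHardy Ω p β :=
  (corollary1p3_general volume hp.le hβ hΩ (by simpa using hdim)).admitsHardy
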